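/- Define random multigraphs (parallel edges and self-loops allowed) as follows. $G_1^1$ is a single vertex $v_1$ with one self-loop. Given $G_1^{t-1}$ on the vertices $v_1,\dots,v_{t-1}$, the multigraph $G_1^t$ is obtained by adding a vertex $v_t$ and a single edge from $v_t$ to $v_i$, where $i\in\{1,\dots,t\}$ is random with $$\Pr[i=s\mid G_1^{t-1}]=\begin{cases}\dfrac{d_{G_1^{t-1}}(v_s)}{2t-1}& 1\le s\le t-1,\\[2mm] \dfrac1{2t-1}& s=t,\end{cases}$$ and where a self-loop counts twice in the degree $d_{G_1^{t-1}}(v_s)$. For $m\ge1$ the preferential attachment graph $G_m^n$ is the multigraph with $n$ vertices and $mn$ edges that is obtained from $G_1^{mn}$ by merging, for each $i=1,\dots,n$, the $m$ consecutive vertices $v_{(i-1)m+1},\dots,v_{im}$ into one vertex. A one-subdivided clique of size $k$ is the graph obtained from the complete graph $K_k$ by replacing every edge by a path of length two through its own new vertex; a multigraph contains it if it has a (not necessarily induced) subgraph isomorphic to it. **Theorem.** There is an absolute constant $c>0$ such that for all integers $m\ge 2$ and $n\ge 1$, the graph $G_m^n$ contains a one-subdivided clique of size $\lfloor (\log_2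 n)^{1/4}\rfloor$ with probability at least $$1-e^{-c(\log_2 n)^{1/4}}.$$ -/

import Mathlib

open scoped ENNReal

/-- A finite multigraph with vertex set `V` whose edges are labelled by `E`: every edge is sent to
its unordered pair of end vertices. Parallel edges and self-loops are allowed. -/
abbrev LabelledMultigraph (V E : Type) : Type := E → Sym2 V

namespace LabelledMultigraph

/-- The degree of `v`: the number of edge ends at `v`, so that a self-loop counts twice. -/
def degree {V E : Type} [DecidableEq V] [Fintype E] (G : LabelledMultigraph V E) (v : V) : ℕ :=
  ∑ e : E, (G e).toMultiset.count v

/-- Identify vertices along a map; the edges (and their multiplicities) are kept. -/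
def merge {V W E : Type} (f : V → W) (G : LabelledMultigraph V E) : LabelledMultigraph W E :=
  fun e => (G e).map f

/-- The underlying simple graph: distinct vertices are adjacent if at least one edge joins them. -/
def toSimple {V E : Type} (G : LabelledMultigraph V E) : SimpleGraph V :=
  SimpleGraph.fromEdgeSet (Set.range G)

/-- Add a new vertex (the last one) and one new edge from it to the vertex `s`, which may be the
new vertex itself. -/
def attach {t : ℕ} (G : LabelledMultigraph (Fin t) (Fin t)) (s : Fin (t + 1)) :
    LabelledMultigraph (Fin (t + 1)) (Fin (t + 1)) :=
  Fin.snoc (α := fun _ => Sym2 (Fin (t + 1)))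
    (fun e => (G e).map Fin.castSucc) s(Fin.last t, s)

/-- The handshake identity: the degrees sum to twice the number of edges. -/
theorem sum_degree {V E : Type} [Fintype V] [DecidableEq V] [Fintype E]
    (G : LabelledMultigraph V E) : ∑ v : V, G.degree v = 2 * Fintype.card E := by
  unfold degree
  rw [Finset.sum_comm]
  have h : ∀ e : E, ∑ v : V, (G e).toMultiset.count v = 2 := by
    intro e
    rw [Multiset.sum_count_eq_card (fun a _ => Finset.mem_univ a), Sym2.card_toMultiset]
  simp [h, mul_comm]

/-- The probability that the new vertex attaches to `s`, given the graph `G` on `t` vertices with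
`t` edges: it is `degree s / (2 * t + 1)` for an old vertex `s`, and `1 / (2 * t + 1)` for the new
vertex. -/
noncomputable def attachProb {t : ℕ} (G : LabelledMultigraph (Fin t) (Fin t)) :
    Fin (t + 1) → ℝ≥0∞ :=
  Fin.snoc (α := fun _ => ℝ≥0∞)
    (fun s : Fin t => (G.degree s : ℝ≥0∞) / (2 * (t : ℝ≥0∞) + 1)) (1 / (2 * (t : ℝ≥0∞) + 1))

theorem sum_attachProb {t : ℕ} (G : LabelledMultigraph (Fin t) (Fin t)) :
    ∑ s, G.attachProb s = 1 := by
  have h : (∑ s : Fin t, (G.degree s : ℝ≥0∞)) = 2 * (t : ℝ≥0∞) := by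
    have := G.sum_degree
    rw [Fintype.card_fin] at this
    exact_mod_cast this
  rw [Fin.sum_univ_castSucc]
  simp only [attachProb, Fin.snoc_castSucc, Fin.snoc_last, div_eq_mul_inv]
  rw [← Finset.sum_mul, h, ← add_mul]
  refine ENNReal.mul_inv_cancel (by positivity) ?_
  exact_mod_cast ENNReal.natCast_ne_top (2 * t + 1)

end LabelledMultigraph

/-- The law of the preferential attachment graph with parameter `1` on `t` vertices, which are
numbered `0, …, t - 1` in the order of insertion. The step from `0` to `1` vertices yields with
probability `1` the single vertex with one self-loop. -/
noncomputable def prefAttachOne : (t : ℕ) → PMF (LabelledMultigraph (Fin t) (Fin t))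
  | 0 => PMF.pure Fin.elim0
  | t + 1 => (prefAttachOne t).bind fun G =>
      (PMF.ofFintype G.attachProb G.sum_attachProb).map G.attach

/-- The law of the preferential attachment graph with parameter `m` on `n` vertices: in the graph
with parameter `1` on `n * m` vertices, every block `i * m, …, i * m + (m - 1)` of `m` consecutive
vertices is merged into the single vertex `i` (`Fin.divNat` is the division by `m`). -/
noncomputable def prefAttach (m n : ℕ) : PMF (LabelledMultigraph (Fin n) (Fin (n * m))) :=
  (prefAttachOne (n * m)).map (LabelledMultigraph.merge Fin.divNat)

/-- The one-subdivision of a simple graph: every edge `e` is replaced by a path of length two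
through a new vertex `Sum.inr e`. -/
def oneSubdivision {V : Type} (H : SimpleGraph V) : SimpleGraph (V ⊕ H.edgeSet) :=
  SimpleGraph.fromRel fun x y => ∃ (v : V) (e : H.edgeSet),
    x = Sum.inl v ∧ y = Sum.inr e ∧ v ∈ (e : Sym2 V)

/-- The multigraph `G` contains a one-subdivided clique of size `k` (with `k` principal vertices)
as a subgraph, not necessarily induced. -/
def LabelledMultigraph.ContainsOneSubdividedClique {V E : Type} (G : LabelledMultigraph V E)
    (k : ℕ) : Prop :=
  (oneSubdivision (⊤ : SimpleGraph (Fin k))).IsContained G.toSimple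

/-- The probability of an event under a discrete law, as a real number. -/
noncomputable def PMF.prob {α : Type} (p : PMF α) (A : Set α) : ℝ :=
  (p.toOuterMeasure A).toReal

/-!
The graph with parameter `1` is encoded by its history `ω`, the sequence of the vertices to which the
successive vertices attach; `run t j F ω` is the conditional expectation of `F` after `j` further
steps. In this encoding a vertex of the merged graph is a block of `m` consecutive vertices. At each
step the degree `D` of a completed block, or of a union of such blocks, grows by one with
probability `D / (2 * t + 1)`.

*Growth of degrees.* For such a degree `D`, the quantity
`(β * (2 * t + 1)) ^ ρ / ((D - 1) * ⋯ * (D - 2 * ρ))` is a supermartingale (`run_potential_le`). Hence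
a block of degree `d` at time `t₀` has degree at least a constant times `d * √(t / t₀)` at time `t`,
up to a probability exponentially small in `ρ`, which may be of the order of `d`. Single blocks start
with a degree of only `m`, which may be too small for this. So take `k` groups of `2 * k` vertices of
the merged graph: at time `2 * k ^ 2 * m` each group has degree at least `2 * k * m`, so none of them
has low degree at a later time `J * m`, `J = 1000 * k ^ 4`, except with probability `k * 4 ^ (-k)`
(`run_lowGroup_le`). By averaging each group contains a vertex of degree at least `4 * k`, and of
order `m * √J / k`; these are the principal vertices.

*Finding the subdivision vertices.* From time `J * m` on, as long as the potentials of the principal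
vertices `a` and `b` stay below `1`, the vertex `j` sends its first two edges to `a` and `b` with
probability at least `1 / (6144 * k ^ 2 * j)`. The sum of these over `J ≤ j < n` is of the order of
`log n / k ^ 2 ≥ k ^ 2 * log 2`, up to lower order terms, so a fixed pair is missed with
probability at most `2 * 4 ^ (-k) + exp (-k)` for large `k` (`run_missed_le`). Distinct pairs get
distinct subdivision vertices, since the first two edges of a vertex determine its pair
(`containsOneSubdividedClique_of_hits`).

*Small `k`.* There the bound asks only for a probability that is bounded below uniformly in `m` and
`n`. Prescribe the first two edges of each of the vertices `k, …, k + k ^ 2 - 1`; each prescribed edge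
occurs with conditional probability at least `1 / (2 * j + 2)`, because every vertex of the merged
graph has degree at least `m` (`prob_contains_pos`).
-/

namespace PrefAttach

open Finset

/-! ### Histories and conditional expectations -/

/-- A history of the process with parameter `1`: vertex `e` sends its edge to vertex `ω e ≤ e`. At
time `t` only the entries before `t` are meaningful. -/
abbrev History : Type := (e : ℕ) → Fin (e + 1)

/-- The total degree, in the graph on `t` vertices, of the `i`-th block of `q` consecutive
vertices, i.e. of the vertices `v` with `v / q = i`. -/
def blockDegree (t q i : ℕ) (ω : History) : ℕ :=
  ∑ e ∈ range t, ((if e / q = i then 1 else 0) + (if (ω e : ℕ) / q = i then 1 else 0))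

/-- The probability that vertex `t` attaches to `s`. -/
noncomputable def stepProb (t : ℕ) (ω : History) (s : Fin (t + 1)) : ℝ :=
  ((blockDegree t 1 s ω : ℝ) + if (s : ℕ) = t then 1 else 0) / (2 * t + 1)

/-- The conditional expectation of `F`, given the history `ω` before time `t`, after the `j` steps
that follow. -/
noncomputable def run : ℕ → ℕ → (History → ℝ) → History → ℝ
  | _, 0, F, ω => F ω
  | t, j + 1, F, ω => ∑ s, stepProb t ω s * run (t + 1) j F (Function.update ω t s)

theorem stepProb_nonneg (t : ℕ) (ω : History) (s : Fin (t + 1)) : 0 ≤ stepProb t ω s := by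
  unfold stepProb
  positivity

/-- The step law as a size-biased choice: pick one of the `2 * t` ends of old edges or the new
vertex, uniformly. -/
theorem sum_stepProb_mul (t : ℕ) (ω : History) (f : ℕ → ℝ) :
    ∑ s, stepProb t ω s * f s = (∑ e ∈ range t, (f e + f (ω e)) + f t) / (2 * t + 1) := by
  have key : ∀ x ≤ t, ∑ s : Fin (t + 1), (if x = (s : ℕ) then (1 : ℝ) else 0) * f s = f x := by
    intro x hx
    rw [Finset.sum_eq_single (⟨x, by omega⟩ : Fin (t + 1))]
    · simp
    · intro b _ hb
      rw [if_neg, zero_mul]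
      rintro rfl
      exact hb rfl
    · simp
  have h1 : ∀ s : Fin (t + 1), stepProb t ω s * f s =
      (∑ e ∈ range t, ((if e = (s : ℕ) then (1 : ℝ) else 0) * f s +
        (if (ω e : ℕ) = (s : ℕ) then (1 : ℝ) else 0) * f s) +
        (if t = (s : ℕ) then (1 : ℝ) else 0) * f s) / (2 * t + 1) := by
    intro s
    simp only [stepProb, blockDegree, Nat.div_one]
    push_cast
    rw [div_mul_eq_mul_div, add_mul, Finset.sum_mul]
    simp only [add_mul, eq_comm (a := t)]
  simp_rw [h1]
  rw [← Finset.sum_div, Finset.sum_add_distrib, Finset.sum_comm, key t le_rfl]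
  congr 2
  refine Finset.sum_congr rfl fun e he => ?_
  have he' := Finset.mem_range.1 he
  rw [Finset.sum_add_distrib, key e he'.le, key (ω e) (by have := (ω e).2; omega)]

theorem sum_stepProb (t : ℕ) (ω : History) : ∑ s, stepProb t ω s = 1 := by
  have h := sum_stepProb_mul t ω (fun _ => 1)
  simp only [mul_one] at h
  rw [h, Finset.sum_const, Finset.card_range, nsmul_eq_mul, div_eq_one_iff_eq (by positivity)]
  ring

theorem sum_stepProb_block (t q i : ℕ) (ω : History) :
    ∑ s, stepProb t ω s * (if (s : ℕ) / q = i then 1 else 0) =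
      ((blockDegree t q i ω : ℝ) + if t / q = i then 1 else 0) / (2 * t + 1) := by
  rw [sum_stepProb_mul t ω (fun v => if v / q = i then 1 else 0)]
  simp [blockDegree]

theorem blockDegree_succ_update (t q i : ℕ) (ω : History) (s : Fin (t + 1)) :
    blockDegree (t + 1) q i (Function.update ω t s) =
      blockDegree t q i ω + ((if t / q = i then 1 else 0) + if (s : ℕ) / q = i then 1 else 0) := by
  unfold blockDegree
  rw [Finset.sum_range_succ]
  congr 1
  · refine Finset.sum_congr rfl fun e he => ?_
    rw [Function.update_of_ne (Finset.mem_range.1 he).ne]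
  · simp

theorem blockDegree_mono {t t' : ℕ} (h : t ≤ t') (q i : ℕ) {ω ω' : History}
    (hω : ∀ e < t, ω' e = ω e) : blockDegree t q i ω ≤ blockDegree t' q i ω' := by
  unfold blockDegree
  refine (Finset.sum_le_sum fun e he => ?_).trans
    (Finset.sum_le_sum_of_subset (Finset.range_mono h))
  rw [hω e (Finset.mem_range.1 he)]

/-- Every vertex contributes its own edge to the degree of its block. -/
theorem le_blockDegree {t q i : ℕ} (h : (i + 1) * q ≤ t) (ω : History) :
    q ≤ blockDegree t q i ω := by
  rcases Nat.eq_zero_or_pos q with rfl | hq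
  · simp
  calc q = ∑ e ∈ Ico (i * q) ((i + 1) * q), 1 := by simp [add_mul]
    _ ≤ ∑ e ∈ Ico (i * q) ((i + 1) * q),
        ((if e / q = i then 1 else 0) + (if (ω e : ℕ) / q = i then 1 else 0)) := by
      refine Finset.sum_le_sum fun e he => ?_
      rw [Finset.mem_Ico] at he
      rw [if_pos (Nat.div_eq_of_lt_le he.1 he.2)]
      omega
    _ ≤ _ := Finset.sum_le_sum_of_subset fun e he => by
      rw [Finset.mem_Ico] at he
      exact Finset.mem_range.2 (by omega)

theorem blockDegree_mul (t q s i : ℕ) (hs : 0 < s) (ω : History) :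
    blockDegree t (q * s) i ω = ∑ a ∈ Ico (i * s) ((i + 1) * s), blockDegree t q a ω := by
  have key : ∀ v : ℕ, (if v / (q * s) = i then 1 else 0) =
      ∑ a ∈ Ico (i * s) ((i + 1) * s), if v / q = a then 1 else 0 := by
    intro v
    rw [Finset.sum_ite_eq, ← Nat.div_div_eq_div_mul]
    congr 1
    rw [Finset.mem_Ico, eq_iff_iff, Nat.div_eq_iff hs]
    rw [add_mul, one_mul]
    omega
  unfold blockDegree
  rw [Finset.sum_comm]
  refine Finset.sum_congr rfl fun e _ => ?_
  rw [Finset.sum_add_distrib, key, key]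

theorem run_mono {t j : ℕ} {F G : History → ℝ} {ω : History}
    (h : ∀ ω' : History, (∀ e < t, ω' e = ω e) → F ω' ≤ G ω') : run t j F ω ≤ run t j G ω := by
  induction j generalizing t ω with
  | zero => exact h ω fun _ _ => rfl
  | succ j ih =>
    refine Finset.sum_le_sum fun s _ => mul_le_mul_of_nonneg_left (ih fun ω' hω' => h ω' ?_)
      (stepProb_nonneg t ω s)
    intro e he
    rw [hω' e (by omega), Function.update_of_ne he.ne]

theorem run_congr {t j : ℕ} {F G : History → ℝ} {ω : History}
    (h : ∀ ω' : History, (∀ e < t, ω' e = ω e) → F ω' = G ω') : run t j F ω = run t j G ω :=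
  le_antisymm (run_mono fun ω' hω' => (h ω' hω').le) (run_mono fun ω' hω' => (h ω' hω').ge)

theorem run_const (t j : ℕ) (c : ℝ) (ω : History) : run t j (fun _ => c) ω = c := by
  induction j generalizing t ω with
  | zero => rfl
  | succ j ih => simp only [run, ih, ← Finset.sum_mul, sum_stepProb, one_mul]

theorem run_add (t j : ℕ) (F G : History → ℝ) (ω : History) :
    run t j (fun ω' => F ω' + G ω') ω = run t j F ω + run t j G ω := by
  induction j generalizing t ω with
  | zero => rfl
  | succ j ih => simp only [run, ih, mul_add, Finset.sum_add_distrib]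

theorem run_const_mul (t j : ℕ) (c : ℝ) (F : History → ℝ) (ω : History) :
    run t j (fun ω' => c * F ω') ω = c * run t j F ω := by
  induction j generalizing t ω with
  | zero => rfl
  | succ j ih => simp only [run, ih, Finset.mul_sum, mul_left_comm]

theorem run_sum {ι : Type} (S : Finset ι) (t j : ℕ) (F : ι → History → ℝ) (ω : History) :
    run t j (fun ω' => ∑ i ∈ S, F i ω') ω = ∑ i ∈ S, run t j (F i) ω := by
  classical
  induction S using Finset.induction_on with
  | empty => simpa using run_const t j 0 ω
  | insert i S hi ih => simp only [Finset.sum_insert hi, run_add, ih]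

/-- The tower property. -/
theorem run_comp (t i j : ℕ) (F : History → ℝ) (ω : History) :
    run t (i + j) F ω = run t i (run (t + i) j F) ω := by
  induction i generalizing t ω with
  | zero => simp [run]
  | succ i ih =>
    rw [show i + 1 + j = (i + j) + 1 by omega]
    simp only [run]
    refine Finset.sum_congr rfl fun s _ => ?_
    rw [ih, show t + 1 + i = t + (i + 1) by omega]

/-! ### The law of the preferential attachment graph -/

/-- The multigraph of a history on the first `t` vertices. -/
def graphOf (t : ℕ) (ω : History) : LabelledMultigraph (Fin t) (Fin t) :=
  fun e => s(e, ⟨ω e, lt_of_lt_of_le (ω e).2 e.2⟩)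

theorem graphOf_succ_update (t : ℕ) (ω : History) (s : Fin (t + 1)) :
    graphOf (t + 1) (Function.update ω t s) = (graphOf t ω).attach s := by
  funext e
  refine Fin.lastCases ?_ (fun e => ?_) e
  · simp only [LabelledMultigraph.attach, Fin.snoc_last, graphOf, Fin.val_last]
    congr 2
    simp
  · simp only [LabelledMultigraph.attach, Fin.snoc_castSucc, graphOf, Sym2.map_mk,
      Fin.val_castSucc]
    congr 2
    simp [Function.update_of_ne e.2.ne]

theorem degree_graphOf (t : ℕ) (ω : History) (v : Fin t) :
    (graphOf t ω).degree v = blockDegree t 1 v ω := by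
  unfold LabelledMultigraph.degree blockDegree
  rw [Finset.sum_range]
  refine Finset.sum_congr rfl fun e _ => ?_
  have h : (graphOf t ω e).toMultiset = {e, ⟨ω e, lt_of_lt_of_le (ω e).2 e.2⟩} := rfl
  rw [h, Multiset.insert_eq_cons, Multiset.count_cons, Multiset.count_singleton]
  simp only [Nat.div_one, Fin.ext_iff, eq_comm (a := (v : ℕ))]
  rw [add_comm]

/-- `stepProb` is the attachment probability of the multigraph encoded by the history. -/
theorem attachProb_graphOf (t : ℕ) (ω : History) (s : Fin (t + 1)) :
    (graphOf t ω).attachProb s = ENNReal.ofReal (stepProb t ω s) := by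
  have h0 : (0 : ℝ) < 2 * t + 1 := by positivity
  have hd : ENNReal.ofReal (2 * t + 1) = 2 * (t : ℝ≥0∞) + 1 := by
    rw [show (2 * (t : ℝ) + 1) = ((2 * t + 1 : ℕ) : ℝ) by push_cast; ring, ENNReal.ofReal_natCast]
    push_cast
    rfl
  unfold stepProb LabelledMultigraph.attachProb
  rw [ENNReal.ofReal_div_of_pos h0, hd]
  refine Fin.lastCases ?_ (fun v => ?_) s
  · have hz : blockDegree t 1 t ω = 0 := by
      refine Finset.sum_eq_zero fun e he => ?_
      have := Finset.mem_range.1 he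
      have := (ω e).2
      rw [if_neg (by simp; omega), if_neg (by simp; omega), add_zero]
    simp [hz]
  · simp [degree_graphOf, v.2.ne]

/-- The expected value of a function under a discrete law. -/
noncomputable def mean {α : Type} (p : PMF α) (F : α → ℝ≥0∞) : ℝ≥0∞ := ∑' a, p a * F a

theorem mean_bind {α β : Type} (p : PMF α) (f : α → PMF β) (F : β → ℝ≥0∞) :
    mean (p.bind f) F = mean p fun a => mean (f a) F := by
  simp only [mean, PMF.bind_apply, ← ENNReal.tsum_mul_right, ← ENNReal.tsum_mul_left]
  rw [ENNReal.tsum_comm]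
  simp only [mul_assoc]

theorem mean_pure {α : Type} (a : α) (F : α → ℝ≥0∞) : mean (PMF.pure a) F = F a := by
  rw [mean, tsum_eq_single a]
  · simp
  · intro b hb
    simp [hb]

theorem mean_map {α β : Type} (p : PMF α) (f : α → β) (F : β → ℝ≥0∞) :
    mean (p.map f) F = mean p fun a => F (f a) := by
  rw [← PMF.bind_pure_comp, mean_bind]
  simp only [Function.comp, mean_pure]

theorem mean_prefAttachOne (t : ℕ) (F : LabelledMultigraph (Fin t) (Fin t) → ℝ)
    (hF : ∀ G, 0 ≤ F G) :
    mean (prefAttachOne t) (fun G => ENNReal.ofReal (F G)) =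
      ENNReal.ofReal (run 0 t (fun ω => F (graphOf t ω)) fun _ => 0) := by
  induction t with
  | zero =>
    rw [prefAttachOne, mean_pure]
    congr 2
    funext e
    exact e.elim0
  | succ t ih =>
    let K : LabelledMultigraph (Fin t) (Fin t) → ℝ :=
      fun G => ∑ s, (G.attachProb s).toReal * F (G.attach s)
    have hK : ∀ G, 0 ≤ K G := fun G =>
      Finset.sum_nonneg fun s _ => mul_nonneg ENNReal.toReal_nonneg (hF _)
    have h1 : ∀ G : LabelledMultigraph (Fin t) (Fin t),
        mean ((PMF.ofFintype G.attachProb G.sum_attachProb).map G.attach)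
          (fun G => ENNReal.ofReal (F G)) = ENNReal.ofReal (K G) := by
      intro G
      rw [mean_map, mean, tsum_fintype, ENNReal.ofReal_sum_of_nonneg
        fun s _ => mul_nonneg ENNReal.toReal_nonneg (hF _)]
      refine Finset.sum_congr rfl fun s _ => ?_
      have hne : G.attachProb s ≠ ∞ := by
        have := PMF.apply_ne_top (PMF.ofFintype G.attachProb G.sum_attachProb) s
        simpa using this
      rw [ENNReal.ofReal_mul ENNReal.toReal_nonneg, ENNReal.ofReal_toReal hne]
      simp
    rw [prefAttachOne, mean_bind]
    simp only [h1]
    have h2 := run_comp 0 t 1 (fun ω => F (graphOf (t + 1) ω)) fun _ => 0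
    rw [zero_add] at h2
    rw [ih K hK, h2]
    simp only [run, K, graphOf_succ_update, attachProb_graphOf,
      ENNReal.toReal_ofReal (stepProb_nonneg _ _ _)]

open Classical in
theorem prob_prefAttach (m n : ℕ) (A : Set (LabelledMultigraph (Fin n) (Fin (n * m)))) :
    (prefAttach m n).prob A = run 0 (n * m)
      (fun ω => if (graphOf (n * m) ω).merge Fin.divNat ∈ A then 1 else 0) fun _ => 0 := by
  have h : (prefAttach m n).toOuterMeasure A = mean (prefAttach m n)
      (fun G => ENNReal.ofReal (if G ∈ A then 1 else 0)) := by
    rw [PMF.toOuterMeasure_apply, mean]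
    refine tsum_congr fun G => ?_
    by_cases hG : G ∈ A <;> simp [hG]
  rw [PMF.prob, h, prefAttach, mean_map,
    mean_prefAttachOne _ (fun G => if G.merge Fin.divNat ∈ A then 1 else 0)
      (fun G => by split_ifs <;> norm_num), ENNReal.toReal_ofReal]
  have := run_const 0 (n * m) 0 fun _ => 0
  refine this.symm.le.trans (run_mono fun ω _ => ?_)
  split_ifs <;> norm_num

/-! ### A supermartingale for degrees -/

/-- The potential of a block of degree `D` at time `t`. Up to lower order terms it is
`(β * (2 * t + 1) / D ^ 2) ^ ρ`; the falling factorial makes the drift exactly computable. -/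
noncomputable def potential (β : ℝ) (ρ t D : ℕ) : ℝ :=
  (β * (2 * t + 1)) ^ ρ / ((D - 1).descFactorial (2 * ρ) : ℝ)

theorem potential_nonneg {β : ℝ} (hβ : 0 ≤ β) (ρ t D : ℕ) : 0 ≤ potential β ρ t D := by
  unfold potential
  positivity

theorem potential_step {β : ℝ} (hβ : 0 ≤ β) {ρ t D : ℕ} (hD : 2 * ρ < D) :
    potential β ρ (t + 1) D + (D : ℝ) / (2 * t + 1) *
      (potential β ρ (t + 1) (D + 1) - potential β ρ (t + 1) D) ≤ potential β ρ t D := by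
  obtain ⟨d, rfl⟩ : ∃ d, D = d + 1 := ⟨D - 1, by omega⟩
  have hf : (0 : ℝ) < d.descFactorial (2 * ρ) := by
    exact_mod_cast Nat.descFactorial_pos.2 (by omega)
  have hg : (0 : ℝ) < (d + 1).descFactorial (2 * ρ) := by
    exact_mod_cast Nat.descFactorial_pos.2 (by omega)
  have hfg : ((d : ℝ) + 1 - 2 * ρ) * (d + 1).descFactorial (2 * ρ) =
      (d + 1) * d.descFactorial (2 * ρ) := by
    have h := Nat.succ_descFactorial d (2 * ρ)
    have h' : ((d + 1 - 2 * ρ : ℕ) : ℝ) * (d + 1).descFactorial (2 * ρ) =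
        ((d + 1 : ℕ) : ℝ) * d.descFactorial (2 * ρ) := by exact_mod_cast h
    rw [Nat.cast_sub hD.le] at h'
    push_cast at h'
    exact h'
  have hfg' : ((d : ℝ) + 1) / (d + 1).descFactorial (2 * ρ) =
      ((d : ℝ) + 1 - 2 * ρ) / d.descFactorial (2 * ρ) := by
    rw [div_eq_div_iff hg.ne' hf.ne']
    exact hfg.symm
  have ht : (0 : ℝ) < 2 * t + 1 := by positivity
  have ht3 : (0 : ℝ) < 2 * t + 3 := by positivity
  -- Bernoulli's inequality compares the drift with the growth of `(2 * t + 1) ^ ρ`.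
  have hb : 1 - 2 * ρ / (2 * (t : ℝ) + 1) ≤ ((2 * t + 1) / (2 * t + 3)) ^ ρ := by
    have h1 := one_add_mul_le_pow (a := -2 / (2 * (t : ℝ) + 3))
      (by rw [le_div_iff₀ ht3]; linarith) ρ
    have h2 : 1 + -2 / (2 * (t : ℝ) + 3) = (2 * t + 1) / (2 * t + 3) := by
      field_simp
      ring
    have h3 : 2 * ρ / (2 * (t : ℝ) + 3) ≤ 2 * ρ / (2 * (t : ℝ) + 1) := by
      apply div_le_div_of_nonneg_left (by positivity) ht (by linarith)
    rw [h2] at h1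
    refine le_trans ?_ h1
    have : (ρ : ℝ) * (-2 / (2 * t + 3)) = -(2 * ρ / (2 * t + 3)) := by ring
    rw [this]
    linarith
  have hc : 0 ≤ (β * (2 * t + 3)) ^ ρ / (d.descFactorial (2 * ρ) : ℝ) := by positivity
  calc potential β ρ (t + 1) (d + 1) + ((d + 1 : ℕ) : ℝ) / (2 * t + 1) *
        (potential β ρ (t + 1) (d + 1 + 1) - potential β ρ (t + 1) (d + 1))
      = (β * (2 * t + 3)) ^ ρ / (d.descFactorial (2 * ρ) : ℝ) +
        (β * (2 * t + 3)) ^ ρ / (2 * t + 1) * (((d : ℝ) + 1) / (d + 1).descFactorial (2 * ρ) -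
          (d + 1) / d.descFactorial (2 * ρ)) := by
        unfold potential
        simp only [Nat.add_sub_cancel]
        push_cast
        rw [show 2 * ((t : ℝ) + 1) + 1 = 2 * t + 3 by ring]
        ring
    _ = (β * (2 * t + 3)) ^ ρ / (d.descFactorial (2 * ρ) : ℝ) *
        (1 - 2 * ρ / (2 * (t : ℝ) + 1)) := by
        rw [hfg']
        field_simp
        ring
    _ ≤ (β * (2 * t + 3)) ^ ρ / (d.descFactorial (2 * ρ) : ℝ) *
        ((2 * t + 1) / (2 * t + 3)) ^ ρ := mul_le_mul_of_nonneg_left hb hc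
    _ = potential β ρ t (d + 1) := by
        unfold potential
        rw [Nat.add_sub_cancel, div_mul_eq_mul_div, ← mul_pow]
        congr 2
        field_simp

theorem potential_le_pow {β c x : ℝ} (hβ : 0 ≤ β) (hx : 0 < x) {ρ t D : ℕ} (hD : 2 * ρ + x ≤ D)
    (h : β * (2 * t + 1) ≤ c * x ^ 2) : potential β ρ t D ≤ c ^ ρ := by
  have hD' : 2 * ρ < D := by
    have : ((2 * ρ : ℕ) : ℝ) < D := by push_cast; linarith
    exact_mod_cast this
  have h1 : ((D - 2 * ρ : ℕ) : ℝ) ^ (2 * ρ) ≤ ((D - 1).descFactorial (2 * ρ) : ℝ) := by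
    have := Nat.pow_sub_le_descFactorial (D - 1) (2 * ρ)
    rw [Nat.sub_add_cancel (by omega)] at this
    exact_mod_cast this
  rw [Nat.cast_sub hD'.le] at h1
  push_cast at h1
  have h2 : x ^ (2 * ρ) ≤ ((D : ℝ) - 2 * ρ) ^ (2 * ρ) :=
    pow_le_pow_left₀ hx.le (by linarith) _
  have h3 : (0 : ℝ) < x ^ (2 * ρ) := by positivity
  unfold potential
  rw [div_le_iff₀ (h3.trans_le (h2.trans h1))]
  have hc : 0 ≤ c := by
    by_contra hc
    have : 0 ≤ β * (2 * (t : ℝ) + 1) := by positivity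
    nlinarith [sq_pos_of_pos hx]
  calc (β * (2 * t + 1)) ^ ρ ≤ (c * x ^ 2) ^ ρ := pow_le_pow_left₀ (by positivity) h _
    _ = c ^ ρ * x ^ (2 * ρ) := by rw [mul_pow, pow_mul]
    _ ≤ _ := mul_le_mul_of_nonneg_left (h2.trans h1) (by positivity)

theorem lt_sq_of_potential_lt_one {β : ℝ} {ρ t D : ℕ} (hD : 2 * ρ < D)
    (h : potential β ρ t D < 1) : β * (2 * t + 1) < (D : ℝ) ^ 2 := by
  unfold potential at h
  have hf : (0 : ℝ) < (D - 1).descFactorial (2 * ρ) := by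
    exact_mod_cast Nat.descFactorial_pos.2 (by omega)
  rw [div_lt_one hf] at h
  have h1 : ((D - 1).descFactorial (2 * ρ) : ℝ) ≤ ((D : ℝ) ^ 2) ^ ρ := by
    rw [← pow_mul]
    have := (Nat.descFactorial_le_pow (D - 1) (2 * ρ)).trans
      (Nat.pow_le_pow_left (Nat.sub_le D 1) (2 * ρ))
    exact_mod_cast this
  exact lt_of_pow_lt_pow_left₀ ρ (by positivity) (h.trans_le h1)

/-- The potential of a completed block is a supermartingale. -/
theorem run_potential_le {β : ℝ} (hβ : 0 ≤ β) {ρ t q i : ℕ} (j : ℕ) (hq : 0 < q)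
    (ht : (i + 1) * q ≤ t) {ω : History} (hD : 2 * ρ < blockDegree t q i ω) :
    run t j (fun ω' => potential β ρ (t + j) (blockDegree (t + j) q i ω')) ω ≤
      potential β ρ t (blockDegree t q i ω) := by
  induction j generalizing t ω with
  | zero => exact le_rfl
  | succ j ih =>
    have hti : t / q ≠ i := by
      have := (Nat.le_div_iff_mul_le hq).2 ht
      omega
    refine le_trans ?_ (potential_step hβ hD)
    set D := blockDegree t q i ω with hDdef
    calc run t (j + 1) (fun ω' => potential β ρ (t + (j + 1))
          (blockDegree (t + (j + 1)) q i ω')) ω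
        ≤ ∑ s, stepProb t ω s * (potential β ρ (t + 1) D +
          (potential β ρ (t + 1) (D + 1) - potential β ρ (t + 1) D) *
            (if (s : ℕ) / q = i then 1 else 0)) := by
          refine Finset.sum_le_sum fun s _ =>
            mul_le_mul_of_nonneg_left ?_ (stepProb_nonneg t ω s)
          have hs := blockDegree_succ_update t q i ω s
          rw [if_neg hti, zero_add, ← hDdef] at hs
          have := ih (t := t + 1) (ω := Function.update ω t s) (by omega) (by rw [hs]; omega)
          rw [show t + (j + 1) = t + 1 + j by omega]
          refine this.trans (le_of_eq ?_)
          rw [hs]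
          split_ifs <;> simp
      _ = _ := by
          simp only [mul_add, Finset.sum_add_distrib, ← Finset.sum_mul, sum_stepProb]
          simp only [mul_left_comm (stepProb t ω _), ← Finset.mul_sum]
          rw [sum_stepProb_block, if_neg hti, ← hDdef]
          ring

/-! ### Joining a pair of vertices -/

/-- The indicator that the vertices `t` and `t + 1` attach to the blocks `a` and `b`. -/
noncomputable def hit (m a b t : ℕ) (ω : History) : ℝ :=
  if (ω t : ℕ) / m = a ∧ (ω (t + 1) : ℕ) / m = b then 1 else 0

theorem hit_nonneg (m a b t : ℕ) (ω : History) : 0 ≤ hit m a b t ω := by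
  unfold hit
  split_ifs <;> norm_num

theorem hit_le_one (m a b t : ℕ) (ω : History) : hit m a b t ω ≤ 1 := by
  unfold hit
  split_ifs <;> norm_num

theorem hit_congr (m a b : ℕ) {t u : ℕ} (h : t + 2 ≤ u) {ω ω' : History}
    (hω : ∀ e < u, ω' e = ω e) : hit m a b t ω' = hit m a b t ω := by
  unfold hit
  rw [hω t (by omega), hω (t + 1) (by omega)]

/-- The next two vertices attach to `a` and `b` independently up to the change of the degree of `b`
and of the normalization in between, and this degree can only grow. -/
theorem le_run_hit (m a b t : ℕ) {j : ℕ} (hj : 2 ≤ j) (ω : History) :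
    (blockDegree t m a ω : ℝ) / (2 * t + 1) * ((blockDegree t m b ω : ℝ) / (2 * t + 3)) ≤
      run t j (hit m a b t) ω := by
  obtain ⟨i, rfl⟩ := Nat.exists_eq_add_of_le hj
  rw [run_comp]
  have h1 : run t 2 (run (t + 2) i (hit m a b t)) ω = run t 2 (hit m a b t) ω := by
    congr 1
    funext ω'
    rw [run_congr (G := fun _ => hit m a b t ω') fun ω'' h => hit_congr m a b le_rfl h, run_const]
  rw [h1]
  have h2 : ∀ s : Fin (t + 1), run (t + 1) 1 (hit m a b t) (Function.update ω t s) =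
      (if (s : ℕ) / m = a then 1 else 0) * (((blockDegree (t + 1) m b (Function.update ω t s) : ℝ) +
        if (t + 1) / m = b then 1 else 0) / (2 * ((t + 1 : ℕ) : ℝ) + 1)) := by
    intro s
    rw [← sum_stepProb_block, Finset.mul_sum]
    simp only [run]
    refine Finset.sum_congr rfl fun s' _ => ?_
    rw [mul_left_comm]
    congr 1
    simp only [hit, Function.update_self]
    rw [Function.update_of_ne (Nat.lt_succ_self t).ne, Function.update_self]
    by_cases h : (s : ℕ) / m = a <;> simp [h]
  calc (blockDegree t m a ω : ℝ) / (2 * t + 1) * ((blockDegree t m b ω : ℝ) / (2 * t + 3))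
      ≤ (∑ s, stepProb t ω s * (if (s : ℕ) / m = a then 1 else 0)) *
        ((blockDegree t m b ω : ℝ) / (2 * t + 3)) := by
        rw [sum_stepProb_block]
        gcongr
        split_ifs <;> norm_num
    _ ≤ run t 2 (hit m a b t) ω := by
        rw [Finset.sum_mul]
        change _ ≤ ∑ s, stepProb t ω s * run (t + 1) 1 (hit m a b t) (Function.update ω t s)
        refine Finset.sum_le_sum fun s _ => ?_
        rw [h2, mul_assoc]
        refine mul_le_mul_of_nonneg_left (mul_le_mul_of_nonneg_left ?_ (by split_ifs <;> norm_num))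
          (stepProb_nonneg t ω s)
        push_cast
        rw [show 2 * ((t : ℝ) + 1) + 1 = 2 * t + 3 by ring]
        have h3 : (blockDegree t m b ω : ℝ) ≤ blockDegree (t + 1) m b (Function.update ω t s) := by
          exact_mod_cast blockDegree_mono (Nat.le_succ t) m b
            fun e he => Function.update_of_ne he.ne _ _
        gcongr
        have : (0 : ℝ) ≤ if (t + 1) / m = b then 1 else 0 := by split_ifs <;> norm_num
        linarith

/-- The indicator that no vertex `j` of the merged graph, `J ≤ j < n`, sends its first two edges to
the vertices `a` and `b`, in this order. -/
noncomputable def missed (m a b J n : ℕ) (ω : History) : ℝ :=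
  ∏ j ∈ Ico J n, (1 - hit m a b (j * m) ω)

theorem missed_nonneg (m a b J n : ℕ) (ω : History) : 0 ≤ missed m a b J n ω :=
  Finset.prod_nonneg fun _ _ => sub_nonneg.2 (hit_le_one m a b _ ω)

theorem missed_le_one (m a b J n : ℕ) (ω : History) : missed m a b J n ω ≤ 1 :=
  Finset.prod_le_one (fun _ _ => sub_nonneg.2 (hit_le_one m a b _ ω)) fun j _ => by
    linarith [hit_nonneg m a b (j * m) ω]

/-- As long as both potentials are below `1`, the degrees of `a` and `b` are at least
`√(β * (2 * t + 1))`, so each vertex joins them with probability at least `β / (2 * t + 3)`; and the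
potentials are supermartingales. -/
theorem run_missed_le {m a b J ρ d : ℕ} {β : ℝ} (hβ : 0 ≤ β) (hβm : β ≤ m) (hm : 2 ≤ m)
    (ha : a < J) (hb : b < J) {ω : History} (hDa : 2 * ρ < blockDegree (J * m) m a ω)
    (hDb : 2 * ρ < blockDegree (J * m) m b ω) :
    run (J * m) (d * m) (missed m a b J (J + d)) ω ≤
      potential β ρ (J * m) (blockDegree (J * m) m a ω) +
      potential β ρ (J * m) (blockDegree (J * m) m b ω) +
      ∏ j ∈ Ico J (J + d), (1 - β / (2 * j * m + 3)) := by
  induction d generalizing J ω with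
  | zero =>
    simp only [Nat.zero_mul, run, add_zero, missed, Ico_self, Finset.prod_empty]
    linarith [potential_nonneg hβ ρ (J * m) (blockDegree (J * m) m a ω),
      potential_nonneg hβ ρ (J * m) (blockDegree (J * m) m b ω)]
  | succ d ih =>
    set Va := potential β ρ (J * m) (blockDegree (J * m) m a ω) with hVa
    set Vb := potential β ρ (J * m) (blockDegree (J * m) m b ω) with hVb
    have hVa0 : 0 ≤ Va := potential_nonneg hβ _ _ _
    have hVb0 : 0 ≤ Vb := potential_nonneg hβ _ _ _
    have hfac : ∀ j ∈ Ico J (J + (d + 1)), 0 ≤ 1 - β / (2 * (j : ℝ) * m + 3) := by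
      intro j hj
      have hj1 : (1 : ℝ) ≤ j := by
        have := (Finset.mem_Ico.1 hj).1
        exact_mod_cast (by omega : 1 ≤ j)
      have hm0 : (0 : ℝ) ≤ m := by positivity
      have : β ≤ 2 * (j : ℝ) * m + 3 := by nlinarith
      rw [sub_nonneg, div_le_one (by positivity)]
      exact this
    have hQ0 := Finset.prod_nonneg hfac
    have hle1 : run (J * m) ((d + 1) * m) (missed m a b J (J + (d + 1))) ω ≤ 1 := by
      rw [← run_const (J * m) ((d + 1) * m) 1 ω]
      exact run_mono fun ω' _ => missed_le_one _ _ _ _ _ _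
    -- If a potential is at least `1`, the bound is trivial; otherwise both degrees are large.
    rcases le_or_gt 1 Va with h | hVa1
    · linarith
    rcases le_or_gt 1 Vb with h | hVb1
    · linarith
    have hsa := lt_sq_of_potential_lt_one hDa hVa1
    have hsb := lt_sq_of_potential_lt_one hDb hVb1
    have hne : Ico J (J + (d + 1)) = insert J (Ico (J + 1) (J + 1 + d)) := by
      ext x
      simp only [Finset.mem_Ico, Finset.mem_insert]
      omega
    have hnot : J ∉ Ico (J + 1) (J + 1 + d) := by simp
    set Q := ∏ j ∈ Ico (J + 1) (J + 1 + d), (1 - β / (2 * (j : ℝ) * m + 3)) with hQ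
    have hQ0' : 0 ≤ Q := Finset.prod_nonneg fun j hj => hfac j (by rw [hne]; simp [hj])
    rw [hne, Finset.prod_insert hnot, ← hQ]
    have hstep : ∀ ω' : History, (∀ e < J * m, ω' e = ω e) →
        run (J * m + m) (d * m) (missed m a b J (J + (d + 1))) ω' ≤
          (potential β ρ (J * m + m) (blockDegree (J * m + m) m a ω') +
          potential β ρ (J * m + m) (blockDegree (J * m + m) m b ω')) +
          (Q + -Q * hit m a b (J * m) ω') := by
      intro ω' hω'
      have h1 : run (J * m + m) (d * m) (missed m a b J (J + (d + 1))) ω' =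
          (1 - hit m a b (J * m) ω') *
            run (J * m + m) (d * m) (missed m a b (J + 1) (J + 1 + d)) ω' := by
        rw [← run_const_mul]
        refine run_congr fun ω'' h => ?_
        rw [missed, hne, Finset.prod_insert hnot, hit_congr m a b (by omega) h, missed]
      have h2 := ih (J := J + 1) (ω := ω') (by omega) (by omega)
        (hDa.trans_le (blockDegree_mono (by nlinarith) m a hω'))
        (hDb.trans_le (blockDegree_mono (by nlinarith) m b hω'))
      rw [add_mul, one_mul] at h2
      rw [h1]
      have h3 := hit_nonneg m a b (J * m) ω'
      have h4 := hit_le_one m a b (J * m) ω'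
      have h5 := potential_nonneg hβ ρ (J * m + m) (blockDegree (J * m + m) m a ω')
      have h6 := potential_nonneg hβ ρ (J * m + m) (blockDegree (J * m + m) m b ω')
      refine (mul_le_mul_of_nonneg_left h2 (by linarith)).trans ?_
      nlinarith
    have hhit : β / (2 * (J : ℝ) * m + 3) ≤ run (J * m) m (hit m a b (J * m)) ω := by
      refine le_trans ?_ (le_run_hit m a b (J * m) hm ω)
      push_cast at hsa hsb ⊢
      set x : ℝ := (blockDegree (J * m) m a ω : ℝ)
      set y : ℝ := (blockDegree (J * m) m b ω : ℝ)
      have hx : 0 ≤ x := Nat.cast_nonneg _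
      have hy : 0 ≤ y := Nat.cast_nonneg _
      have hp : 0 ≤ β * (2 * ((J : ℝ) * m) + 1) := by positivity
      have hxy : β * (2 * ((J : ℝ) * m) + 1) ≤ x * y := by
        refine le_of_sq_le_sq ?_ (by positivity)
        rw [mul_pow x y, sq (β * _)]
        exact mul_le_mul hsa.le hsb.le hp (by positivity)
      rw [div_mul_div_comm, div_le_div_iff₀ (by positivity) (by positivity)]
      have h3 : 0 ≤ 2 * ((J : ℝ) * m) + 3 := by positivity
      nlinarith [mul_le_mul_of_nonneg_right hxy h3]
    rw [add_mul, one_mul, add_comm (d * m) m, run_comp]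
    refine (run_mono hstep).trans ?_
    rw [run_add, run_add, run_add, run_const, run_const_mul]
    have hA := run_potential_le hβ (ρ := ρ) (t := J * m) (q := m) (i := a) m (by omega)
      (Nat.mul_le_mul_right m ha) hDa
    have hB := run_potential_le hβ (ρ := ρ) (t := J * m) (q := m) (i := b) m (by omega)
      (Nat.mul_le_mul_right m hb) hDb
    have := mul_le_mul_of_nonneg_left hhit hQ0'
    nlinarith

/-! ### From hits to subdivided cliques -/

/-- Distinct pairs need distinct subdivision vertices: this is automatic, because the first two
edges of a vertex determine the pair that it joins. -/
theorem containsOneSubdividedClique_of_hits {m n k J : ℕ} (hm : 2 ≤ m) {ω : History}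
    (a : Fin k → ℕ) (ha : Function.Injective a) (haJ : ∀ g, a g < J)
    (hits : ∀ g h, ∃ j, J ≤ j ∧ j < n ∧ (ω (j * m) : ℕ) / m = a g ∧
      (ω (j * m + 1) : ℕ) / m = a h) :
    ((graphOf (n * m) ω).merge Fin.divNat).ContainsOneSubdividedClique k := by
  choose j hjJ hjn hj1 hj2 using hits
  have han : ∀ g, a g < n := fun g => (haJ g).trans ((hjJ g g).trans_lt (hjn g g))
  let H : SimpleGraph (Fin k) := ⊤
  let fst : H.edgeSet → Fin k := fun e => (Quot.out (e : Sym2 (Fin k))).1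
  let snd : H.edgeSet → Fin k := fun e => (Quot.out (e : Sym2 (Fin k))).2
  have hout : ∀ e : H.edgeSet, s(fst e, snd e) = (e : Sym2 (Fin k)) := fun e => Quot.out_eq _
  let f : Fin k ⊕ H.edgeSet → Fin n :=
    Sum.elim (fun g => ⟨a g, han g⟩) (fun e => ⟨j (fst e) (snd e), hjn _ _⟩)
  have hlt : ∀ g e, f (Sum.inl g) < f (Sum.inr e) := fun g e =>
    Fin.lt_def.2 ((haJ g).trans_le (hjJ _ _))
  have hinj : Function.Injective f := by
    rintro (g | e) (g' | e') h
    · exact congrArg _ (ha (Fin.mk.inj_iff.1 h))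
    · exact absurd h (hlt g e').ne
    · exact absurd h (hlt g' e).ne'
    · have h' : j (fst e) (snd e) = j (fst e') (snd e') := Fin.mk.inj_iff.1 h
      have h1 : fst e = fst e' := ha (by rw [← hj1 (fst e) (snd e), h', hj1])
      have h2 : snd e = snd e' := ha (by rw [← hj2 (fst e) (snd e), h', hj2])
      congr 1
      exact Subtype.ext (by rw [← hout e, ← hout e', h1, h2])
  have hadj : ∀ (v : Fin k) (e : H.edgeSet), v ∈ (e : Sym2 (Fin k)) →
      ((graphOf (n * m) ω).merge Fin.divNat).toSimple.Adj (f (Sum.inl v)) (f (Sum.inr e)) := by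
    intro v e hv
    rw [LabelledMultigraph.toSimple, SimpleGraph.fromEdgeSet_adj]
    refine ⟨?_, (hlt v e).ne⟩
    rw [← hout e, Sym2.mem_iff] at hv
    have hjm : j (fst e) (snd e) * m + m ≤ n * m := by
      have := Nat.mul_le_mul_right m (hjn (fst e) (snd e))
      rwa [Nat.succ_mul] at this
    rcases hv with hv | hv
    · refine ⟨⟨j (fst e) (snd e) * m, by omega⟩, ?_⟩
      simp only [LabelledMultigraph.merge, graphOf, Sym2.map_mk]
      rw [Sym2.eq_swap]
      congr 2
      · exact Fin.ext (by simpa [Fin.divNat, f, hv] using hj1 (fst e) (snd e))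
      · exact Fin.ext (by
          simp only [Fin.divNat, f, Sum.elim_inr]
          exact Nat.mul_div_cancel _ (by omega))
    · refine ⟨⟨j (fst e) (snd e) * m + 1, by omega⟩, ?_⟩
      simp only [LabelledMultigraph.merge, graphOf, Sym2.map_mk]
      rw [Sym2.eq_swap]
      congr 2
      · exact Fin.ext (by simpa [Fin.divNat, f, hv] using hj2 (fst e) (snd e))
      · exact Fin.ext (by
          simp only [Fin.divNat, f, Sum.elim_inr]
          rw [mul_comm, Nat.mul_add_div (by omega), Nat.div_eq_of_lt (by omega), add_zero])
  refine ⟨⟨⟨f, fun {x y} hxy => ?_⟩, hinj⟩⟩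
  rw [oneSubdivision, SimpleGraph.fromRel_adj] at hxy
  rcases hxy.2 with ⟨v, e, rfl, rfl, hv⟩ | ⟨v, e, rfl, rfl, hv⟩
  · exact hadj v e hv
  · exact (hadj v e hv).symm

open Classical in
/-- The indicator that the merged graph contains a one-subdivided clique of size `k`. -/
noncomputable def cliqueInd (m n k : ℕ) (ω : History) : ℝ :=
  if ((graphOf (n * m) ω).merge Fin.divNat).ContainsOneSubdividedClique k then 1 else 0

theorem cliqueInd_nonneg (m n k : ℕ) (ω : History) : 0 ≤ cliqueInd m n k ω := by
  unfold cliqueInd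
  split_ifs <;> norm_num

theorem prob_contains (m n k : ℕ) :
    (prefAttach m n).prob {G | G.ContainsOneSubdividedClique k} =
      run 0 (n * m) (cliqueInd m n k) fun _ => 0 :=
  prob_prefAttach m n _

/-! ### A uniform lower bound for cliques of fixed size -/

/-- Every prescribed edge of the vertex `j` has conditional probability at least `1 / (2 * j + 2)`,
whatever the history. -/
theorem le_run_prod_hit {m J d : ℕ} (hm : 2 ≤ m) (a b : ℕ → ℕ) (ha : ∀ j, a j < J)
    (hb : ∀ j, b j < J) (ω : History) :
    ∏ j ∈ Ico J (J + d), (1 / (2 * (j : ℝ) + 2)) ^ 2 ≤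
      run (J * m) (d * m) (fun ω' => ∏ j ∈ Ico J (J + d), hit m (a j) (b j) (j * m) ω') ω := by
  induction d generalizing J ω with
  | zero => simp [run]
  | succ d ih =>
    have hne : Ico J (J + (d + 1)) = insert J (Ico (J + 1) (J + 1 + d)) := by
      ext x
      simp only [Finset.mem_Ico, Finset.mem_insert]
      omega
    have hnot : J ∉ Ico (J + 1) (J + 1 + d) := by simp
    simp only [hne, Finset.prod_insert hnot]
    set Q := ∏ j ∈ Ico (J + 1) (J + 1 + d), (1 / (2 * (j : ℝ) + 2)) ^ 2 with hQ
    have hQ0 : 0 ≤ Q := Finset.prod_nonneg fun j _ => sq_nonneg _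
    have hhit : (1 / (2 * (J : ℝ) + 2)) ^ 2 ≤ run (J * m) m (hit m (a J) (b J) (J * m)) ω := by
      refine le_trans ?_ (le_run_hit m (a J) (b J) (J * m) hm ω)
      have h2 : (2 : ℝ) ≤ m := by exact_mod_cast hm
      have hA : (m : ℝ) ≤ blockDegree (J * m) m (a J) ω := by
        exact_mod_cast le_blockDegree (Nat.mul_le_mul_right m (ha J)) ω
      have hB : (m : ℝ) ≤ blockDegree (J * m) m (b J) ω := by
        exact_mod_cast le_blockDegree (Nat.mul_le_mul_right m (hb J)) ω
      push_cast
      rw [sq]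
      refine mul_le_mul ?_ ?_ (by positivity) (by positivity)
      · rw [div_le_div_iff₀ (by positivity) (by positivity)]
        nlinarith [Nat.cast_nonneg (α := ℝ) J]
      · rw [div_le_div_iff₀ (by positivity) (by positivity)]
        nlinarith [Nat.cast_nonneg (α := ℝ) J]
    rw [add_mul, one_mul, add_comm (d * m) m, run_comp]
    calc (1 / (2 * (J : ℝ) + 2)) ^ 2 * Q
        ≤ Q * run (J * m) m (hit m (a J) (b J) (J * m)) ω := by
          rw [mul_comm]
          exact mul_le_mul_of_nonneg_left hhit hQ0
      _ = run (J * m) m (fun ω' => Q * hit m (a J) (b J) (J * m) ω') ω := by rw [run_const_mul]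
      _ ≤ _ := run_mono fun ω' _ => ?_
    have h1 : run (J * m + m) (d * m) (fun ω'' => hit m (a J) (b J) (J * m) ω'' *
          ∏ j ∈ Ico (J + 1) (J + 1 + d), hit m (a j) (b j) (j * m) ω'') ω' =
        hit m (a J) (b J) (J * m) ω' * run (J * m + m) (d * m)
          (fun ω'' => ∏ j ∈ Ico (J + 1) (J + 1 + d), hit m (a j) (b j) (j * m) ω'') ω' := by
      rw [← run_const_mul]
      refine run_congr fun ω'' h => ?_
      rw [hit_congr m _ _ (by omega) h]
    have h2 := ih (J := J + 1) (fun j => (ha j).trans (Nat.lt_succ_self J))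
      (fun j => (hb j).trans (Nat.lt_succ_self J)) ω'
    rw [add_mul, one_mul] at h2
    rw [h1, mul_comm]
    exact mul_le_mul_of_nonneg_left h2 (hit_nonneg _ _ _ _ _)

/-- For fixed `k` the probability is bounded below uniformly in `m` and `n`: with positive
probability, the vertex `k + (g * k + h)` joins `g` and `h` for all `g, h < k`. -/
theorem prob_contains_pos (k : ℕ) : ∃ δ : ℝ, 0 < δ ∧ ∀ m n : ℕ, 2 ≤ m → k + k * k ≤ n →
    δ ≤ (prefAttach m n).prob {G | G.ContainsOneSubdividedClique k} := by
  rcases Nat.eq_zero_or_pos k with rfl | hk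
  · refine ⟨1, one_pos, fun m n hm _ => ?_⟩
    rw [prob_contains, ← run_const 0 (n * m) 1 fun _ => 0]
    refine run_mono fun ω _ => ?_
    rw [cliqueInd, if_pos]
    exact containsOneSubdividedClique_of_hits (J := 0) hm Fin.elim0 (fun g => g.elim0)
      (fun g => g.elim0) (fun g => g.elim0)
  refine ⟨∏ j ∈ Ico k (k + k * k), (1 / (2 * (j : ℝ) + 2)) ^ 2,
    Finset.prod_pos fun j _ => by positivity, fun m n hm hn => ?_⟩
  obtain ⟨r, rfl⟩ := Nat.exists_eq_add_of_le hn
  let a : ℕ → ℕ := fun j => (j - k) / k % k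
  let b : ℕ → ℕ := fun j => (j - k) % k
  let P : History → ℝ := fun ω => ∏ j ∈ Ico k (k + k * k), hit m (a j) (b j) (j * m) ω
  have hP : ∀ ω, P ω ≤ cliqueInd m (k + k * k + r) k ω := by
    intro ω
    by_cases h : ∀ j ∈ Ico k (k + k * k), hit m (a j) (b j) (j * m) ω ≠ 0
    · have h1 : P ω ≤ 1 := Finset.prod_le_one (fun j _ => hit_nonneg _ _ _ _ _)
        fun j _ => hit_le_one _ _ _ _ _
      refine h1.trans (le_of_eq ?_)
      rw [cliqueInd, if_pos]
      refine containsOneSubdividedClique_of_hits (J := k) hm (fun g => (g : ℕ)) Fin.val_injective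
        (fun g => g.2) fun g g' => ⟨k + (g * k + g'), by omega, ?_, ?_⟩
      · have := g.2
        have := g'.2
        nlinarith
      · have hg' := g'.2
        have hlt : (g : ℕ) * k + g' < k * k := by
          have := g.2
          nlinarith
        have h2 := h (k + (g * k + g')) (Finset.mem_Ico.2 ⟨by omega, by omega⟩)
        have ha : a (k + (g * k + g')) = g := by
          simp only [a, Nat.add_sub_cancel_left]
          rw [mul_comm, Nat.mul_add_div hk, Nat.div_eq_of_lt hg', add_zero, Nat.mod_eq_of_lt g.2]
        have hb : b (k + (g * k + g')) = g' := by
          simp only [b, Nat.add_sub_cancel_left]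
          rw [mul_comm, Nat.mul_add_mod, Nat.mod_eq_of_lt hg']
        rw [ha, hb, hit] at h2
        by_contra h3
        exact h2 (if_neg h3)
    · push Not at h
      obtain ⟨j, hj, h0⟩ := h
      exact (Finset.prod_eq_zero hj h0).le.trans (cliqueInd_nonneg _ _ _ _)
  rw [prob_contains, show (k + k * k + r) * m = k * m + (k * k * m + r * m) by ring, run_comp,
    ← run_const 0 (k * m) (∏ j ∈ Ico k (k + k * k), (1 / (2 * (j : ℝ) + 2)) ^ 2) fun _ => 0]
  refine run_mono fun ω _ => ?_
  rw [zero_add]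
  refine (le_run_prod_hit hm a b (fun j => Nat.mod_lt _ hk) (fun j => Nat.mod_lt _ hk) ω).trans ?_
  rw [run_comp]
  refine run_mono fun ω' _ => ?_
  rw [← run_const (k * m + k * k * m) (r * m)
    (∏ j ∈ Ico k (k + k * k), hit m (a j) (b j) (j * m) ω') ω']
  refine run_mono fun ω'' h => (le_of_eq ?_).trans (hP ω'')
  refine Finset.prod_congr rfl fun j hj => (hit_congr m _ _ ?_ h).symm
  have := Finset.mem_Ico.1 hj
  have : (j + 1) * m ≤ (k + k * k) * m := Nat.mul_le_mul_right m (by omega)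
  nlinarith

/-! ### Choice of the principal vertices -/

/-- The indicator that the vertices of the `g`-th group of `2 * k` consecutive vertices of the
merged graph have total degree less than about `m * √(J / 12)` at time `J * m`. -/
noncomputable def lowGroup (k m J g : ℕ) (ω : History) : ℝ :=
  if (blockDegree (J * m) (m * (2 * k)) g ω : ℝ) ^ 2 ≤ m / 24 * (2 * ((J * m : ℕ) : ℝ) + 1) then 1
  else 0

theorem lowGroup_nonneg (k m J g : ℕ) (ω : History) : 0 ≤ lowGroup k m J g ω := by
  unfold lowGroup
  split_ifs <;> norm_num

theorem run_lowGroup_le {k m J g : ℕ} (hk : 1 ≤ k) (hm : 2 ≤ m) (hg : g < k)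
    (hJ : 2 * k ^ 2 ≤ J) (ω : History) :
    run 0 (J * m) (lowGroup k m J g) ω ≤ (1 / 4) ^ k := by
  have hle : 2 * k ^ 2 * m ≤ J * m := Nat.mul_le_mul_right m hJ
  obtain ⟨r, hr⟩ := Nat.exists_eq_add_of_le hle
  have hkR : (1 : ℝ) ≤ k := by exact_mod_cast hk
  have hmR : (2 : ℝ) ≤ m := by exact_mod_cast hm
  have hq : 0 < m * (2 * k) := by positivity
  have hβ : (0 : ℝ) ≤ (m : ℝ) / 24 := by positivity
  have ht : (g + 1) * (m * (2 * k)) ≤ 2 * k ^ 2 * m := by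
    have : (g + 1) * (m * (2 * k)) ≤ k * (m * (2 * k)) := Nat.mul_le_mul_right _ hg
    linarith [this, show k * (m * (2 * k)) = 2 * k ^ 2 * m by ring]
  have hkm : 2 * k < m * (2 * k) := by nlinarith
  have hmain : ∀ ω' : History, run (2 * k ^ 2 * m) r (lowGroup k m J g) ω' ≤ (1 / 4) ^ k := by
    intro ω'
    have hD := le_blockDegree ht ω'
    have hD' : 2 * k < blockDegree (2 * k ^ 2 * m) (m * (2 * k)) g ω' := hkm.trans_le hD
    have h1 : run (2 * k ^ 2 * m) r (lowGroup k m J g) ω' ≤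
        run (2 * k ^ 2 * m) r (fun ω'' => potential (m / 24) k (2 * k ^ 2 * m + r)
          (blockDegree (2 * k ^ 2 * m + r) (m * (2 * k)) g ω'')) ω' := by
      refine run_mono fun ω'' h => ?_
      rw [← hr, lowGroup]
      split_ifs with h2
      · by_contra! h3
        have h4 : 2 * k < blockDegree (J * m) (m * (2 * k)) g ω'' :=
          hD'.trans_le (blockDegree_mono hle _ _ h)
        have := lt_sq_of_potential_lt_one h4 h3
        linarith
      · exact potential_nonneg hβ _ _ _
    refine h1.trans ((run_potential_le hβ r hq ht hD').trans ?_)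
    have hDR : (m : ℝ) * (2 * k) ≤ blockDegree (2 * k ^ 2 * m) (m * (2 * k)) g ω' := by
      exact_mod_cast hD
    refine potential_le_pow (x := k * m) hβ (by positivity) ?_ ?_
    · nlinarith
    · push_cast
      have : (1 : ℝ) ≤ k ^ 2 := by nlinarith
      have h3 : (m : ℝ) ≤ k ^ 2 * m ^ 2 := by nlinarith [mul_nonneg (sq_nonneg (k : ℝ)) hβ]
      nlinarith
  rw [hr, run_comp, ← run_const 0 (2 * k ^ 2 * m) ((1 / 4) ^ k) ω]
  refine run_mono fun ω' _ => ?_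
  rw [zero_add]
  exact hmain ω'

/-- Factors `1 - ε / j` multiply to at most `(J / (J + d)) ^ ε`, by comparing the harmonic sum with the
logarithm. -/
theorem prod_one_sub_le_exp {ε : ℝ} {γ : ℕ → ℝ} {J : ℕ} (hε : 0 ≤ ε) (hJ : 1 ≤ J)
    (h0 : ∀ j, J ≤ j → γ j ≤ 1) (h : ∀ j, J ≤ j → ε / j ≤ γ j) (d : ℕ) :
    ∏ j ∈ Ico J (J + d), (1 - γ j) ≤
      Real.exp (-(ε * (Real.log ((J + d : ℕ) : ℝ) - Real.log J))) := by
  induction d with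
  | zero => simp
  | succ d ih =>
    rw [← add_assoc, Finset.prod_Ico_succ_top (by omega)]
    have hpos : (0 : ℝ) < ((J + d : ℕ) : ℝ) := by exact_mod_cast (by omega : 0 < J + d)
    have hlog : Real.log ((J + d + 1 : ℕ) : ℝ) - Real.log ((J + d : ℕ) : ℝ) ≤
        1 / ((J + d : ℕ) : ℝ) := by
      rw [← Real.log_div (by positivity) hpos.ne']
      refine (Real.log_le_sub_one_of_pos (by positivity)).trans (le_of_eq ?_)
      push_cast at hpos ⊢
      field_simp
      ring
    have h1 : 1 - γ (J + d) ≤ Real.exp (-(ε * (Real.log ((J + d + 1 : ℕ) : ℝ) -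
        Real.log ((J + d : ℕ) : ℝ)))) := by
      refine le_trans ?_ (Real.add_one_le_exp _)
      have h2 := h (J + d) (by omega)
      have h3 := mul_le_mul_of_nonneg_left hlog hε
      rw [mul_one_div] at h3
      linarith
    refine (mul_le_mul ih h1 (sub_nonneg.2 (h0 _ (by omega))) (Real.exp_nonneg _)).trans
      (le_of_eq ?_)
    rw [← Real.exp_add]
    congr 1
    ring

/-- If no group has low degree, each group contains a vertex of large degree, by averaging; these
vertices are the principal vertices. -/
theorem run_one_sub_cliqueInd_le {k m J d : ℕ} (hk : 1 ≤ k) (hm : 2 ≤ m) (hJ : 1000 * k ^ 4 ≤ J)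
    (ω : History) :
    run (J * m) (d * m) (fun ω' => 1 - cliqueInd m (J + d) k ω') ω ≤
      ∑ g ∈ range k, lowGroup k m J g ω + (k : ℝ) ^ 2 * ((1 / 4) ^ k + (1 / 4) ^ k +
        Real.exp (-(1 / (6144 * (k : ℝ) ^ 2) * (Real.log ((J + d : ℕ) : ℝ) - Real.log J)))) := by
  have hkR : (1 : ℝ) ≤ k := by exact_mod_cast hk
  have hmR : (2 : ℝ) ≤ m := by exact_mod_cast hm
  have hsum0 : 0 ≤ ∑ g ∈ range k, lowGroup k m J g ω :=
    Finset.sum_nonneg fun g _ => lowGroup_nonneg _ _ _ _ _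
  set E := Real.exp (-(1 / (6144 * (k : ℝ) ^ 2) * (Real.log ((J + d : ℕ) : ℝ) - Real.log J)))
    with hE
  have hE0 : 0 < E := Real.exp_pos _
  by_cases hlow : ∃ g < k, lowGroup k m J g ω ≠ 0
  · obtain ⟨g, hg, hne⟩ := hlow
    have h1 : lowGroup k m J g ω = 1 := by
      unfold lowGroup at hne ⊢
      split_ifs at hne ⊢ with h
      · rfl
      · exact absurd rfl hne
    have h2 : (1 : ℝ) ≤ ∑ g ∈ range k, lowGroup k m J g ω := by
      rw [← h1]
      exact Finset.single_le_sum (f := fun g => lowGroup k m J g ω)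
        (fun g _ => lowGroup_nonneg _ _ _ _ _) (Finset.mem_range.2 hg)
    have h3 : run (J * m) (d * m) (fun ω' => 1 - cliqueInd m (J + d) k ω') ω ≤ 1 := by
      refine (run_mono (G := fun _ => 1) fun ω' _ => ?_).trans (run_const _ _ 1 ω).le
      linarith [cliqueInd_nonneg m (J + d) k ω']
    have h4 : 0 ≤ (k : ℝ) ^ 2 * ((1 / 4) ^ k + (1 / 4) ^ k + E) := by positivity
    linarith
  push Not at hlow
  -- A group has squared degree above `m / 24 * (2 * t + 1)`, so its best vertex has squared degree at
  -- least `m / (96 * k ^ 2) * (2 * t + 1) = 16 * β * (2 * t + 1)`. The factor `16` brings the initial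
  -- potential of that vertex below `4 ^ (-k)`.
  set β : ℝ := (m : ℝ) / (1536 * (k : ℝ) ^ 2) with hβdef
  have hβ : 0 ≤ β := by positivity
  have hβm : β ≤ m := div_le_self (by positivity) (by nlinarith)
  have hJR : 1000 * (k : ℝ) ^ 4 ≤ J := by exact_mod_cast hJ
  have hk4 : (1 : ℝ) ≤ (k : ℝ) ^ 4 := one_le_pow₀ hkR
  have hJ2 : 2 * k ^ 2 ≤ J := by
    have : k ^ 2 ≤ k ^ 4 := Nat.pow_le_pow_right hk (by norm_num)
    omega
  have hsel : ∀ g : Fin k, ∃ a, a / (2 * k) = g ∧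
      16 * (β * (2 * ((J * m : ℕ) : ℝ) + 1)) ≤ (blockDegree (J * m) m a ω : ℝ) ^ 2 := by
    intro g
    have hD : (m : ℝ) / 24 * (2 * ((J * m : ℕ) : ℝ) + 1) <
        (blockDegree (J * m) (m * (2 * k)) g ω : ℝ) ^ 2 := by
      by_contra! h
      have := hlow g g.2
      rw [lowGroup, if_pos h] at this
      exact one_ne_zero this
    rw [blockDegree_mul _ _ _ _ (by omega)] at hD
    set S := Ico ((g : ℕ) * (2 * k)) (((g : ℕ) + 1) * (2 * k)) with hS
    have hcard : S.card = 2 * k := by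
      rw [hS, Nat.card_Ico, add_mul, one_mul, Nat.add_sub_cancel_left]
    have hne : S.Nonempty := by
      rw [← Finset.card_pos, hcard]
      omega
    obtain ⟨a, haS, hmax⟩ := Finset.exists_max_image S (fun a => blockDegree (J * m) m a ω) hne
    refine ⟨a, ?_, ?_⟩
    · rw [hS, Finset.mem_Ico] at haS
      exact Nat.div_eq_of_lt_le haS.1 haS.2
    · have h1 : ∑ b ∈ S, blockDegree (J * m) m b ω ≤ 2 * k * blockDegree (J * m) m a ω := by
        rw [← hcard, ← smul_eq_mul]
        exact Finset.sum_le_card_nsmul _ _ _ hmax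
      have h2 : ((∑ b ∈ S, blockDegree (J * m) m b ω : ℕ) : ℝ) ^ 2 ≤
          (2 * k * (blockDegree (J * m) m a ω : ℝ)) ^ 2 :=
        pow_le_pow_left₀ (Nat.cast_nonneg _) (by exact_mod_cast h1) 2
      have h3 := hD.le.trans h2
      rw [hβdef, ← mul_le_mul_iff_right₀ (show (0 : ℝ) < 4 * k ^ 2 by positivity)]
      refine le_trans (le_of_eq ?_) (h3.trans (le_of_eq ?_))
      · field_simp
        ring
      · ring
  choose a ha hdeg using hsel
  have hinj : Function.Injective a := by
    intro g g' h
    exact Fin.ext (by rw [← ha g, ← ha g', h])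
  have haJ : ∀ g, a g < J := by
    intro g
    have h1 : a g < (g + 1) * (2 * k) := by
      rw [← Nat.div_lt_iff_lt_mul (by omega), ha]
      omega
    have h2 : ((g : ℕ) + 1) * (2 * k) ≤ k * (2 * k) := Nat.mul_le_mul_right _ g.2
    nlinarith
  have hbig : ∀ g, 4 * (k : ℝ) ≤ blockDegree (J * m) m (a g) ω := by
    intro g
    refine le_of_sq_le_sq ((le_trans ?_ (hdeg g))) (Nat.cast_nonneg _)
    rw [hβdef]
    push_cast
    have h1 : 16 * ((m : ℝ) / (1536 * (k : ℝ) ^ 2) * (2 * ((J : ℝ) * m) + 1)) =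
        (m * (2 * (J * m) + 1)) / (96 * (k : ℝ) ^ 2) := by
      field_simp
      ring
    rw [h1, le_div_iff₀ (by positivity)]
    have h2 : (4 : ℝ) * J ≤ m * (2 * (J * m) + 1) := by
      nlinarith [mul_nonneg (Nat.cast_nonneg (α := ℝ) J) (sub_nonneg.2 hmR)]
    nlinarith
  have hlt : ∀ g, 2 * k < blockDegree (J * m) m (a g) ω := by
    intro g
    have : ((2 * k : ℕ) : ℝ) < blockDegree (J * m) m (a g) ω := by
      push_cast
      linarith [hbig g]
    exact_mod_cast this
  have hpot : ∀ g, potential β k (J * m) (blockDegree (J * m) m (a g) ω) ≤ (1 / 4) ^ k := by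
    intro g
    refine potential_le_pow (x := blockDegree (J * m) m (a g) ω / 2) hβ ?_ ?_ ?_
    · linarith [hbig g]
    · linarith [hbig g]
    · linarith [hdeg g]
  have hJ1 : 1 ≤ J := by
    have : 1 ≤ k ^ 4 := Nat.one_le_pow _ _ hk
    omega
  have hprod : ∏ j ∈ Ico J (J + d), (1 - β / (2 * (j : ℝ) * m + 3)) ≤ E := by
    refine prod_one_sub_le_exp (by positivity) hJ1 (fun j hj => ?_) (fun j hj => ?_) d
    all_goals
      have hj1 : (1 : ℝ) ≤ j := by exact_mod_cast hJ1.trans hj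
      have hjm : 2 ≤ (j : ℝ) * m := by nlinarith
    · rw [div_le_one (by positivity)]
      nlinarith
    · rw [hβdef, div_div, div_div, div_le_div_iff₀ (by positivity) (by positivity)]
      nlinarith [mul_nonneg (sq_nonneg (k : ℝ)) (by linarith : (0 : ℝ) ≤ 2 * (j * m) - 3)]
  have hpt : ∀ ω' : History, 1 - cliqueInd m (J + d) k ω' ≤
      ∑ g : Fin k, ∑ h : Fin k, missed m (a g) (a h) J (J + d) ω' := by
    intro ω'
    have h0 : ∀ g h : Fin k, 0 ≤ missed m (a g) (a h) J (J + d) ω' :=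
      fun g h => missed_nonneg _ _ _ _ _ _
    by_cases hall : ∀ g h : Fin k, ∃ j ∈ Ico J (J + d), hit m (a g) (a h) (j * m) ω' ≠ 0
    · have hone : cliqueInd m (J + d) k ω' = 1 := by
        rw [cliqueInd, if_pos]
        refine containsOneSubdividedClique_of_hits hm a hinj haJ fun g h => ?_
        obtain ⟨j, hj, hne⟩ := hall g h
        rw [Finset.mem_Ico] at hj
        refine ⟨j, hj.1, hj.2, ?_⟩
        by_contra hcon
        exact hne (if_neg hcon)
      rw [hone, sub_self]
      exact Finset.sum_nonneg fun g _ => Finset.sum_nonneg fun h _ => h0 g h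
    · push Not at hall
      obtain ⟨g, h, hz⟩ := hall
      have hone : missed m (a g) (a h) J (J + d) ω' = 1 :=
        Finset.prod_eq_one fun j hj => by rw [hz j hj, sub_zero]
      calc 1 - cliqueInd m (J + d) k ω' ≤ missed m (a g) (a h) J (J + d) ω' := by
            rw [hone]
            linarith [cliqueInd_nonneg m (J + d) k ω']
        _ ≤ ∑ h : Fin k, missed m (a g) (a h) J (J + d) ω' :=
            Finset.single_le_sum (f := fun h => missed m (a g) (a h) J (J + d) ω')
              (fun h _ => h0 g h) (Finset.mem_univ h)
        _ ≤ _ := Finset.single_le_sum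
              (f := fun g => ∑ h : Fin k, missed m (a g) (a h) J (J + d) ω')
              (fun g _ => Finset.sum_nonneg fun h _ => h0 g h) (Finset.mem_univ g)
  calc run (J * m) (d * m) (fun ω' => 1 - cliqueInd m (J + d) k ω') ω
      ≤ ∑ g : Fin k, ∑ h : Fin k,
          run (J * m) (d * m) (missed m (a g) (a h) J (J + d)) ω := by
        refine (run_mono fun ω' _ => hpt ω').trans (le_of_eq ?_)
        rw [run_sum]
        exact Finset.sum_congr rfl fun g _ => run_sum _ _ _ _ _
    _ ≤ ∑ _g : Fin k, ∑ _h : Fin k, ((1 / 4) ^ k + (1 / 4) ^ k + E) := by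
        refine Finset.sum_le_sum fun g _ => Finset.sum_le_sum fun h _ => ?_
        have h1 := run_missed_le (d := d) hβ hβm hm (haJ g) (haJ h) (hlt g) (hlt h)
        linarith [hpot g, hpot h, hprod]
    _ = (k : ℝ) ^ 2 * ((1 / 4) ^ k + (1 / 4) ^ k + E) := by
        simp only [Finset.sum_const, Finset.card_univ, Fintype.card_fin, nsmul_eq_mul]
        ring
    _ ≤ _ := by linarith

theorem one_sub_prob_contains_le {k m n J : ℕ} (hk : 1 ≤ k) (hm : 2 ≤ m) (hJ : 1000 * k ^ 4 ≤ J)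
    (hn : J ≤ n) :
    1 - (prefAttach m n).prob {G | G.ContainsOneSubdividedClique k} ≤
      k * (1 / 4) ^ k + (k : ℝ) ^ 2 * ((1 / 4) ^ k + (1 / 4) ^ k +
        Real.exp (-(1 / (6144 * (k : ℝ) ^ 2) * (Real.log n - Real.log J)))) := by
  obtain ⟨d, rfl⟩ := Nat.exists_eq_add_of_le hn
  have hJ2 : 2 * k ^ 2 ≤ J := by
    have : k ^ 2 ≤ k ^ 4 := Nat.pow_le_pow_right hk (by norm_num)
    omega
  rw [prob_contains]
  have h1 : 1 - run 0 ((J + d) * m) (cliqueInd m (J + d) k) (fun _ => 0) =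
      run 0 ((J + d) * m) (fun ω => 1 + -1 * cliqueInd m (J + d) k ω) (fun _ => 0) := by
    rw [run_add, run_const, run_const_mul]
    ring
  rw [h1, add_mul, run_comp]
  refine (run_mono (G := fun ω => ∑ g ∈ range k, lowGroup k m J g ω + (k : ℝ) ^ 2 *
    ((1 / 4) ^ k + (1 / 4) ^ k + Real.exp (-(1 / (6144 * (k : ℝ) ^ 2) *
      (Real.log ((J + d : ℕ) : ℝ) - Real.log J))))) fun ω _ => ?_).trans ?_
  · rw [zero_add]
    have := run_one_sub_cliqueInd_le (d := d) hk hm hJ ω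
    simpa only [neg_one_mul, ← sub_eq_add_neg] using this
  · rw [run_add, run_const, run_sum]
    gcongr
    refine (Finset.sum_le_sum fun g hg => run_lowGroup_le hk hm (Finset.mem_range.1 hg) hJ2 _).trans
      (le_of_eq ?_)
    simp

/-! ### Explicit bounds -/

theorem one_sub_prob_contains_le_exp {k m n : ℕ} (hk : 10000 ≤ k) (hm : 2 ≤ m)
    (hn : 2 ^ k ^ 4 ≤ n) :
    1 - (prefAttach m n).prob {G | G.ContainsOneSubdividedClique k} ≤
      Real.exp (-((k : ℝ) / 2)) := by
  have hpow : ∀ x : ℕ, 14 ≤ x → 1000 * x ≤ 2 ^ x := by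
    intro x hx
    induction x, hx using Nat.le_induction with
    | base => norm_num
    | succ x hx ih =>
      rw [pow_succ]
      omega
  have hk4 : k ≤ k ^ 4 := Nat.le_self_pow (by norm_num) k
  have hJn : 1000 * k ^ 4 ≤ n := (hpow _ (by omega)).trans hn
  refine (one_sub_prob_contains_le (by omega) hm le_rfl hJn).trans ?_
  have hkR : (10000 : ℝ) ≤ k := by exact_mod_cast hk
  have hk0 : (0 : ℝ) < k := by linarith
  have hlogn : 0.69 * (k : ℝ) ^ 4 ≤ Real.log n := by
    have h1 : Real.log (2 ^ k ^ 4) ≤ Real.log n :=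
      Real.log_le_log (by positivity) (by exact_mod_cast hn)
    rw [Real.log_pow] at h1
    push_cast at h1
    have h2 : (0.69 : ℝ) ≤ Real.log 2 := by linarith [Real.log_two_gt_d9]
    nlinarith [pow_pos hk0 4]
  have hlogJ : Real.log ((1000 * k ^ 4 : ℕ) : ℝ) ≤ 1000 + 4 * k := by
    push_cast
    rw [Real.log_mul (by norm_num) (by positivity), Real.log_pow]
    have h1 := Real.log_le_sub_one_of_pos (show (0 : ℝ) < 1000 by norm_num)
    have h2 := Real.log_le_sub_one_of_pos hk0
    push_cast
    linarith
  have hexp : Real.exp (-(1 / (6144 * (k : ℝ) ^ 2) *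
      (Real.log n - Real.log ((1000 * k ^ 4 : ℕ) : ℝ)))) ≤ Real.exp (-(k : ℝ)) := by
    rw [Real.exp_le_exp, neg_le_neg_iff, one_div, inv_mul_eq_div, le_div_iff₀ (by positivity)]
    have h3 : 10000 * (k : ℝ) ^ 3 ≤ (k : ℝ) ^ 4 := by
      rw [pow_succ _ 3, mul_comm]
      exact mul_le_mul_of_nonneg_left hkR (by positivity)
    have h4 : (k : ℝ) * 10000 ≤ (k : ℝ) ^ 3 := by
      rw [pow_succ, mul_comm]
      exact mul_le_mul_of_nonneg_right (by nlinarith) hk0.le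
    nlinarith
  have hquarter : ((1 : ℝ) / 4) ^ k ≤ Real.exp (-(k : ℝ)) := by
    have h1 : (1 : ℝ) / 4 ≤ Real.exp (-1) := by
      rw [Real.exp_neg, one_div]
      exact inv_anti₀ (Real.exp_pos _) (by linarith [Real.exp_one_lt_d9])
    refine (pow_le_pow_left₀ (by norm_num) h1 k).trans (le_of_eq ?_)
    rw [← Real.exp_nat_mul]
    congr 1
    ring
  have hhalf : 4 * (k : ℝ) ^ 2 ≤ Real.exp ((k : ℝ) / 2) := by
    have h1 := Real.pow_div_factorial_le_exp ((k : ℝ) / 2) (by positivity) 3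
    norm_num [Nat.factorial] at h1
    refine le_trans ?_ h1
    nlinarith [pow_pos hk0 2]
  set x := Real.exp (-(k : ℝ)) with hx
  have hx0 : 0 < x := Real.exp_pos _
  calc k * (1 / 4 : ℝ) ^ k + (k : ℝ) ^ 2 * ((1 / 4) ^ k + (1 / 4) ^ k + _)
      ≤ k * x + (k : ℝ) ^ 2 * (x + x + x) := by gcongr
    _ ≤ 4 * (k : ℝ) ^ 2 * x := by
        have : (k : ℝ) ≤ (k : ℝ) ^ 2 := by nlinarith
        nlinarith
    _ ≤ Real.exp ((k : ℝ) / 2) * x := mul_le_mul_of_nonneg_right hhalf hx0.le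
    _ = Real.exp (-((k : ℝ) / 2)) := by
        rw [hx, ← Real.exp_add]
        congr 1
        ring

end PrefAttach

theorem mainTheorem1 :
    ∃ c : ℝ, 0 < c ∧ ∀ m n : ℕ, 2 ≤ m → 1 ≤ n →
      1 - Real.exp (-c * Real.logb 2 (n : ℝ) ^ (1 / 4 : ℝ)) ≤
        (prefAttach m n).prob
          {G | G.ContainsOneSubdividedClique ⌊Real.logb 2 (n : ℝ) ^ (1 / 4 : ℝ)⌋₊} := by
  -- Below `k = 10000` the constant `c` is taken so small that `c * L` is at most the uniform lower
  -- bound for the probability.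
  choose δ hδ0 hδ using PrefAttach.prob_contains_pos
  obtain ⟨k₀, -, hmin⟩ := Finset.exists_min_image (Finset.range 10000) δ ⟨0, by simp⟩
  refine ⟨min (1 / 4) (δ k₀ / 10000), lt_min (by norm_num) (div_pos (hδ0 _) (by norm_num)),
    fun m n hm hn => ?_⟩
  set c := min (1 / 4) (δ k₀ / 10000)
  set L := Real.logb 2 (n : ℝ) ^ (1 / 4 : ℝ) with hL
  set k := ⌊L⌋₊ with hk
  have hlog0 : 0 ≤ Real.logb 2 (n : ℝ) :=
    Real.logb_nonneg (by norm_num) (by exact_mod_cast hn)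
  have hL0 : 0 ≤ L := Real.rpow_nonneg hlog0 _
  have hkL : (k : ℝ) ≤ L := Nat.floor_le hL0
  have hLk : L < k + 1 := Nat.lt_floor_add_one L
  have hL4 : L ^ 4 = Real.logb 2 (n : ℝ) := by
    rw [hL, ← Real.rpow_natCast, ← Real.rpow_mul hlog0]
    norm_num
  have hkn : 2 ^ k ^ 4 ≤ n := by
    have h1 : ((k ^ 4 : ℕ) : ℝ) ≤ Real.logb 2 n := by
      rw [← hL4]
      push_cast
      exact pow_le_pow_left₀ (Nat.cast_nonneg _) hkL 4
    rw [Real.le_logb_iff_rpow_le (by norm_num) (by exact_mod_cast hn), Real.rpow_natCast] at h1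
    exact_mod_cast h1
  rcases lt_or_ge k 10000 with hlt | hge
  · have hkk : k + k * k ≤ n := by
      have h1 : k ^ 4 + 1 ≤ 2 ^ k ^ 4 := Nat.lt_two_pow_self
      have h2 : k + k * k ≤ k ^ 4 + 1 := by
        rcases Nat.lt_or_ge k 2 with h | h
        · interval_cases k <;> norm_num
        · have h3 : 4 ≤ k * k := Nat.mul_le_mul h h
          have h4 : k ^ 4 = k * k * (k * k) := by ring
          nlinarith
      omega
    refine le_trans ?_ (hδ k m n hm hkk)
    have h1 : c * L ≤ δ k₀ := by
      have h2 : L ≤ 10000 := by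
        have : (k : ℝ) + 1 ≤ 10000 := by exact_mod_cast hlt
        linarith
      have h3 : c ≤ δ k₀ / 10000 := min_le_right _ _
      calc c * L ≤ δ k₀ / 10000 * 10000 :=
            mul_le_mul h3 h2 hL0 (div_pos (hδ0 _) (by norm_num)).le
        _ = δ k₀ := by ring
    have h4 := Real.add_one_le_exp (-c * L)
    have h5 := hmin k (Finset.mem_range.2 hlt)
    linarith
  · have h1 := PrefAttach.one_sub_prob_contains_le_exp hge hm hkn
    have h2 : Real.exp (-((k : ℝ) / 2)) ≤ Real.exp (-c * L) := by
      rw [Real.exp_le_exp]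
      have h3 : c ≤ 1 / 4 := min_le_left _ _
      have h4 : (10000 : ℝ) ≤ k := by exact_mod_cast hge
      nlinarith
    linarith
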